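/- Let $\mathbb K$ be the field of real or of complex numbers; all Banach spaces are over $\mathbb K$. The density of a Banach space is the least cardinality of a dense subset. A Banach space $V$ is of universal disposition for separable spaces if for all separable Banach spaces $X\subseteq Y$, every linear isometric embedding of $X$ into $V$ extends to a linear isometric embedding of $Y$ into $V$. A Banach space $E$ is $1$-separably injective if for all separable Banach spaces $X\subseteq Y$, every bounded linear operator $T\colon X\to E$ extends to a bounded linear operator $\tilde T\colon Y\to E$ with $\|\tilde T\|\le\|T\|$. A subspace $F$ of a Banach space $V$ is $1$-complemented in $V$ if there is a linear operator $P\colon V\to V$ with $P\circ P=P$, $\|P\|\le 1$ and $P[V]=F$. \textbf{Theorem.} Assume the continuum hypothesis. Then there exists a Banach space $V$ of density $\aleph_1$ that is of universal disposition for separable spaces, and it is unique up to linear isometry. Moreover, a Banach space $E$ of density at most $\aleph_1$ is linearly isometric to a $1$-complemented subspace of $V$ if and only if $E$ is $1$-separably injective. -/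

import Mathlib

open Cardinal

universe u

/-- The density (density character) of a topological space: the least cardinality of a
dense subset. -/
noncomputable def density (X : Type u) [TopologicalSpace X] : Cardinal.{u} :=
  ⨅ s : {s : Set X // Dense s}, #s.1

/-- `V` is of universal disposition for separable spaces: whenever `X ⊆ Y` are separable Banach
spaces, every linear isometric embedding of `X` into `V` extends to a linear isometric
embedding of `Y` into `V`. -/
def UniversalDispositionForSeparable (𝕜 : Type*) [RCLike 𝕜] (V : Type u)
    [NormedAddCommGroup V] [NormedSpace 𝕜 V] : Prop :=
  ∀ (Y : Type u) [NormedAddCommGroup Y] [NormedSpace 𝕜 Y] [CompleteSpace Y]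
    [TopologicalSpace.SeparableSpace Y] (X : Submodule 𝕜 Y), IsClosed (X : Set Y) →
    ∀ f : X →ₗᵢ[𝕜] V, ∃ g : Y →ₗᵢ[𝕜] V, ∀ x : X, g x = f x

/-- `E` is 1-separably injective: whenever `X ⊆ Y` are separable Banach spaces, every bounded
linear operator `T : X → E` extends to a bounded linear operator `Y → E` of no greater norm. -/
def OneSeparablyInjective (𝕜 : Type*) [RCLike 𝕜] (E : Type u)
    [NormedAddCommGroup E] [NormedSpace 𝕜 E] : Prop :=
  ∀ (Y : Type u) [NormedAddCommGroup Y] [NormedSpace 𝕜 Y] [CompleteSpace Y]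
    [TopologicalSpace.SeparableSpace Y] (X : Submodule 𝕜 Y), IsClosed (X : Set Y) →
    ∀ T : X →L[𝕜] E, ∃ T' : Y →L[𝕜] E, (∀ x : X, T' x = T x) ∧ ‖T'‖ ≤ ‖T‖

/-- The subspace `F` of `V` is 1-complemented: it is the range of a linear projection of norm at
most 1. (If `F ≠ 0`, the norm is then exactly 1; if `F = 0`, the only projection is `0`.) -/
def IsOneComplemented {𝕜 : Type*} [RCLike 𝕜] {V : Type u}
    [NormedAddCommGroup V] [NormedSpace 𝕜 V] (F : Submodule 𝕜 V) : Prop :=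
  ∃ P : V →L[𝕜] V, P ∘L P = P ∧ ‖P‖ ≤ 1 ∧ LinearMap.range (P : V →ₗ[𝕜] V) = F

/-! The basic tool is the pushout of seminormed spaces, `amalgam`: contractions that agree on the
common part glue, and a factor stays isometrically embedded when its seminorm is dominated along the
common part by that of the other factor.

A space of universal disposition is 1-separably injective. Rescale `Y` so that `T` becomes
contractive and push `T` out along `X ⊆ Y`; the separable range of `T` is isometric in the pushout,
and an isometric extension of its inclusion restricts on `Y` to an extension of `T`. The property
passes to 1-complemented subspaces.

Conversely, around a 1-separably injective `E` of size at most continuum one builds a chain of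
length `ω₁` of extensions by countably many generators, each with a contractive retraction onto `E`.
A step (`Stage.exists_extension`) is a pushout realizing one prescribed extension of a countably
generated part; injectivity of `E` extends the retraction. There are continuum many such tasks, so
under CH the chain meets them all (`exists_generic_chain`), and every countable part of the limit
already lies in some stage. The completed limit is of universal disposition
(`universalDispositionForSeparable_of_realizes`) and contains `E` as a 1-complemented subspace; `E =
0` gives existence.

Uniqueness is a back-and-forth argument of length `ω₁` through isometries of separable subspaces. It
also identifies the space built around `E` with the given `V`. -/

/-- `X` has at most continuum many elements; stated so that `X` may live in any universe. -/
def Coded (X : Type*) : Prop := Nonempty (X ↪ ℝ)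

/-! ### Sets of size at most continuum -/

namespace Coded

theorem of_injective {X Y : Type*} (hY : Coded Y) (f : X → Y) (hf : Function.Injective f) :
    Coded X :=
  hY.map fun e => ⟨fun x => e (f x), fun _ _ h => hf (e.injective h)⟩

theorem of_mk_le {X : Type} (h : #X ≤ 𝔠) : Coded X := by
  rw [← mk_real] at h
  exact h

theorem of_mk_le_continuum {X : Type*} (h : #X ≤ 𝔠) : Coded X := by
  have h1 : lift.{0} #X ≤ lift #ℝ := by
    simpa [mk_real] using h
  exact lift_mk_le'.1 h1

theorem mk_le {X : Type*} (h : Coded X) : #X ≤ 𝔠 := by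
  have h1 : lift.{0} #X ≤ lift #ℝ := lift_mk_le'.2 h
  simpa [mk_real] using h1

theorem of_countable (X : Type*) [Countable X] : Coded X :=
  of_mk_le_continuum ((mk_le_aleph0 (α := X)).trans aleph0_le_continuum)

theorem small {X : Type*} (h : Coded X) : Small.{u} X := by
  obtain ⟨e⟩ := h
  exact small_of_injective e.injective

theorem seq {X : Type*} (h : Coded X) : Coded (ℕ → X) := by
  obtain ⟨e⟩ := h
  have h1 : Coded (ℕ → ℝ) := of_mk_le (by simp [mk_real])
  exact h1.of_injective (fun s n => e (s n)) fun s t hst => funext fun n =>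
    e.injective (congrFun hst n)

theorem prod {X Y : Type*} (hX : Coded X) (hY : Coded Y) : Coded (X × Y) := by
  obtain ⟨e⟩ := hX
  obtain ⟨f⟩ := hY
  have h1 : Coded (ℝ × ℝ) := of_mk_le (by simp [mk_real])
  exact h1.of_injective _ (e.injective.prodMap f.injective)

theorem sum {X Y : Type*} (hX : Coded X) (hY : Coded Y) : Coded (X ⊕ Y) := by
  obtain ⟨e⟩ := hX
  obtain ⟨f⟩ := hY
  have h1 : Coded (ℝ ⊕ ℝ) := of_mk_le (by simp [mk_real])
  exact h1.of_injective _ (Sum.map_injective.2 ⟨e.injective, f.injective⟩)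

theorem real : Coded ℝ := ⟨Function.Embedding.refl _⟩

theorem rclike (𝕜 : Type*) [RCLike 𝕜] : Coded 𝕜 :=
  (real.prod real).of_injective (fun z : 𝕜 => (RCLike.re z, RCLike.im z)) fun z w h => by
    simp only [Prod.mk.injEq] at h
    exact RCLike.ext h.1 h.2

theorem list {X : Type*} (h : Coded X) : Coded (List X) := by
  obtain ⟨e⟩ := h
  have h1 : Coded (List ℝ) := of_mk_le (by simp [mk_real])
  exact h1.of_injective _ (List.map_injective_iff.2 e.injective)

/-- A finitely supported function is coded by a list enumerating its graph over the support;
membership in the list recovers the function, so the chosen order is harmless. -/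
theorem finsupp {X Y : Type*} [Zero Y] (hX : Coded X) (hY : Coded Y) : Coded (X →₀ Y) := by
  classical
  refine (hX.prod hY).list.of_injective
    (fun f : X →₀ Y => f.support.toList.map fun x => (x, f x)) fun f g h => ?_
  have key : ∀ f : X →₀ Y, ∀ x y, (x, y) ∈ f.support.toList.map (fun x => (x, f x)) ↔
      f x = y ∧ y ≠ 0 := by
    intro f x y
    simp only [List.mem_map, Finset.mem_toList, Finsupp.mem_support_iff, Prod.mk.injEq]
    constructor
    · rintro ⟨z, hz, rfl, rfl⟩
      exact ⟨rfl, hz⟩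
    · rintro ⟨rfl, hy⟩
      exact ⟨x, hy, rfl, rfl⟩
  have h2 : ∀ x y, (f x = y ∧ y ≠ 0) ↔ (g x = y ∧ y ≠ 0) := fun x y => by
    rw [← key f, ← key g]
    simp only at h
    rw [h]
  ext x
  by_cases hx : f x = 0
  · by_contra hne
    have := (h2 x (g x)).2 ⟨rfl, fun h0 => hne (hx.trans h0.symm)⟩
    exact hne this.1
  · exact ((h2 x (f x)).1 ⟨rfl, hx⟩).1.symm

/-- A metric space in which a set of size at most continuum is dense has size at most
continuum. -/
theorem of_denseRange {X Y : Type*} [MetricSpace X] (hY : Coded Y) (f : Y → X)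
    (hf : DenseRange f) : Coded X := by
  have : ∀ x : X, ∃ s : ℕ → Y, Filter.Tendsto (fun n => f (s n)) Filter.atTop (nhds x) := by
    intro x
    have h1 : ∀ n : ℕ, ∃ y, dist x (f y) < 1 / ((n : ℝ) + 1) := fun n =>
      hf.exists_dist_lt x (by positivity)
    choose s hs using h1
    refine ⟨s, ?_⟩
    rw [tendsto_iff_dist_tendsto_zero]
    refine squeeze_zero (fun _ => dist_nonneg) (fun n => ?_)
      tendsto_one_div_add_atTop_nhds_zero_nat
    rw [dist_comm]
    exact (hs n).le
  choose s hs using this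
  refine hY.seq.of_injective s fun x y h => ?_
  have := hs y
  rw [← h] at this
  exact tendsto_nhds_unique (hs x) this

end Coded

/-! ### Recursion of length `ω₁` -/

/-- The well-order `ω₁`. -/
theorem exists_omega_one_order :
    ∃ (I : Type) (_ : LinearOrder I) (_ : WellFoundedLT I), Nonempty I ∧ #I = aleph 1 ∧
      (∀ i : I, (Set.Iio i).Countable) ∧ ∀ s : ℕ → I, ∃ b, ∀ n, s n ≤ b := by
  have hcard : #((aleph 1).ord.ToType) = aleph 1 := by simp
  have hc : ∀ i : (aleph 1).ord.ToType, (Set.Iio i).Countable := by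
    intro i
    have h1 : #(Set.Iio i) < aleph 1 := (mk_Iio_lt i (by simp)).trans_eq hcard
    exact Cardinal.le_aleph0_iff_set_countable.1
      (Order.lt_succ_iff.1 (h1.trans_eq succ_aleph0.symm))
  refine ⟨(aleph 1).ord.ToType, inferInstance, inferInstance, ?_, hcard, hc, ?_⟩
  · rw [← Cardinal.mk_ne_zero_iff, hcard]
    exact (aleph_pos 1).ne'
  · intro s
    by_contra! hs
    have hu : (Set.univ : Set (aleph 1).ord.ToType) = ⋃ n, Set.Iio (s n) := by
      ext b
      simpa using hs b
    have h2 : (Set.univ : Set (aleph 1).ord.ToType).Countable := by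
      rw [hu]
      exact Set.countable_iUnion fun n => hc _
    have h3 := Cardinal.le_aleph0_iff_set_countable.2 h2
    rw [mk_univ, hcard, ← Cardinal.succ_aleph0] at h3
    exact absurd h3 (not_le.2 (Order.lt_succ _))

/-- Under the continuum hypothesis, a nonempty set of size at most continuum is the image of a
set of size `ℵ₁`. -/
theorem Coded.exists_surjective (CH : continuum.{0} = aleph 1) {I : Type} (hI : #I = aleph 1)
    {T : Type*} [Nonempty T] (hT : Coded T) : ∃ τ : I → T, Function.Surjective τ := by
  obtain ⟨e⟩ := hT
  have : #ℝ = #I := by rw [mk_real, CH, hI]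
  obtain ⟨f⟩ := Cardinal.eq.1 this
  exact ⟨Function.invFun (fun t => f (e t)),
    Function.invFun_surjective fun x y h => e.injective (f.injective h)⟩

/-- In a preorder in which increasing sequences are bounded, every nonempty countable directed
family is bounded. -/
theorem bddAbove_of_countable_directed {P : Type*} [Preorder P]
    (hP : ∀ s : ℕ → P, Monotone s → ∃ b, ∀ n, s n ≤ b) {J : Type*} [Countable J] [Nonempty J]
    (f : J → P) (hf : Directed (· ≤ ·) f) : ∃ b, ∀ j, f j ≤ b := by
  have := Encodable.ofCountable J
  have : Inhabited J := Classical.inhabited_of_nonempty ‹_›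
  obtain ⟨b, hb⟩ := hP _ (hf.sequence_mono)
  exact ⟨b, fun j => (hf.le_sequence j).trans (hb _)⟩

/-- A chain of length `ω₁` through a countably closed preorder that meets every task which is
applicable from some point on. -/
theorem exists_generic_chain {P : Type*} [Preorder P] (p₀ : P)
    (hP : ∀ s : ℕ → P, Monotone s → ∃ b, ∀ n, s n ≤ b)
    {I : Type*} [LinearOrder I] [WellFoundedLT I] (hI : ∀ i : I, (Set.Iio i).Countable)
    {T : Type*} (τ : I → T) (hτ : Function.Surjective τ) (App Met : T → P → Prop)
    (h : ∀ t p, App t p → ∃ q, p ≤ q ∧ Met t q) :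
    ∃ c : I → P, Monotone c ∧ ∀ t, (∃ i₀, ∀ i, i₀ ≤ i → App t (c i)) → ∃ j, Met t (c j) := by
  classical
  -- The second alternative is inherited by all larger conditions. Hence one visit per task
  -- suffices: a task not met at its turn can never become applicable later.
  let D : I → P → Prop := fun i p => Met (τ i) p ∨ ∀ q, p ≤ q → ¬ App (τ i) q
  have hD : ∀ i p, ∃ q, p ≤ q ∧ D i q := by
    intro i p
    by_cases hp : ∃ q, p ≤ q ∧ App (τ i) q
    · obtain ⟨q, hpq, hq⟩ := hp
      obtain ⟨r, hqr, hr⟩ := h _ _ hq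
      exact ⟨r, hpq.trans hqr, Or.inl hr⟩
    · push Not at hp
      exact ⟨p, le_rfl, Or.inr hp⟩
  -- The default `p₀` is never taken: `key` shows that the condition holds at every index.
  let c : I → P := WellFoundedLT.fix fun i (ih : ∀ j, j < i → P) =>
    if hq : ∃ q, D i q ∧ ∀ j (hj : j < i), ih j hj ≤ q then hq.choose else p₀
  have hc : ∀ i, c i = if hq : ∃ q, D i q ∧ ∀ j, j < i → c j ≤ q then hq.choose else p₀ :=
    fun i => WellFoundedLT.fix_eq _ i
  have key : ∀ i, D i (c i) ∧ ∀ j, j < i → c j ≤ c i := by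
    intro i
    induction i using WellFoundedLT.induction with
    | ind i ih =>
      have hq : ∃ q, D i q ∧ ∀ j, j < i → c j ≤ q := by
        have hb : ∃ b, ∀ j, j < i → c j ≤ b := by
          rcases (Set.Iio i).eq_empty_or_nonempty with he | hne
          · exact ⟨p₀, fun j hj => absurd (show j ∈ Set.Iio i from hj) (he ▸ Set.notMem_empty j)⟩
          · have := hne.to_subtype
            have := (hI i).to_subtype
            have hm : Monotone fun j : Set.Iio i => c j := by
              intro a b hab
              rcases hab.lt_or_eq with hlt | rfl
              · exact (ih b b.2).2 a hlt
              · exact le_rfl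
            obtain ⟨b, hb⟩ := bddAbove_of_countable_directed hP _ hm.directed_le
            exact ⟨b, fun j hj => hb ⟨j, hj⟩⟩
        obtain ⟨b, hb⟩ := hb
        obtain ⟨q, hbq, hq⟩ := hD i b
        exact ⟨q, hq, fun j hj => (hb j hj).trans hbq⟩
      have := hc i
      rw [dif_pos hq] at this
      rw [this]
      exact hq.choose_spec
  have hmono : Monotone c := by
    intro a b hab
    rcases hab.lt_or_eq with hlt | rfl
    · exact (key b).2 a hlt
    · exact le_rfl
  refine ⟨c, hmono, fun t ⟨i₀, hi₀⟩ => ?_⟩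
  obtain ⟨i, rfl⟩ := hτ t
  refine ⟨i, (key i).1.resolve_right fun hn => ?_⟩
  exact hn (c (max i i₀)) (hmono (le_max_left _ _)) (hi₀ _ (le_max_right _ _))

/-! ### Density -/

theorem density_le_mk {X : Type u} [TopologicalSpace X] {s : Set X} (hs : Dense s) :
    density X ≤ #s :=
  ciInf_le' (fun s : {s : Set X // Dense s} => #s.1) ⟨s, hs⟩

theorem exists_dense_mk_eq_density (X : Type u) [TopologicalSpace X] :
    ∃ s : Set X, Dense s ∧ #s = density X := by
  have : Nonempty {s : Set X // Dense s} := ⟨⟨Set.univ, dense_univ⟩⟩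
  obtain ⟨s, hs⟩ := ciInf_mem fun s : {s : Set X // Dense s} => #s.1
  exact ⟨s.1, s.2, hs⟩

theorem aleph_one_le_density {X : Type u} [TopologicalSpace X]
    (h : ¬ TopologicalSpace.SeparableSpace X) : aleph 1 ≤ density X := by
  by_contra! hlt
  rw [← Cardinal.succ_aleph0, Order.lt_succ_iff] at hlt
  obtain ⟨s, hs, hs'⟩ := exists_dense_mk_eq_density X
  rw [← hs'] at hlt
  exact h ⟨s, Cardinal.le_aleph0_iff_set_countable.1 hlt, hs⟩

theorem continuum_eq_aleph_one (CH : continuum.{0} = aleph 1) : continuum.{u} = aleph 1 := by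
  have := congrArg lift.{u} CH
  simpa using this

/-! ### Pushouts of seminormed spaces -/

section Amalgam

variable {𝕜 : Type*} [RCLike 𝕜] {U U' N : Type*} [AddCommGroup U] [Module 𝕜 U]
  [AddCommGroup U'] [Module 𝕜 U'] [AddCommGroup N] [Module 𝕜 N]

theorem amalgam_bddBelow (p : Seminorm 𝕜 U) (q : Seminorm 𝕜 U') (i : N →ₗ[𝕜] U)
    (j : N →ₗ[𝕜] U') (x : U × U') :
    BddBelow (Set.range fun n => p (x.1 - i n) + q (x.2 + j n)) :=
  ⟨0, by rintro _ ⟨n, rfl⟩; positivity⟩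

/-- The pushout seminorm: the largest seminorm on `U × U'` which is at most `p` on `U`, at most
`q` on `U'`, and vanishes on all the `(i n, -j n)`. -/
noncomputable def amalgam (p : Seminorm 𝕜 U) (q : Seminorm 𝕜 U') (i : N →ₗ[𝕜] U)
    (j : N →ₗ[𝕜] U') : Seminorm 𝕜 (U × U') :=
  Seminorm.ofSMulLE (fun x => ⨅ n, p (x.1 - i n) + q (x.2 + j n))
    (le_antisymm
      ((ciInf_le (amalgam_bddBelow p q i j 0) 0).trans (by simp))
      (le_ciInf fun n => by positivity))
    (fun x y => by
      refine le_ciInf_add_ciInf fun m n => ?_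
      refine (ciInf_le (amalgam_bddBelow p q i j (x + y)) (m + n)).trans ?_
      have h1 : (x + y).1 - i (m + n) = (x.1 - i m) + (y.1 - i n) := by
        simp only [Prod.fst_add, map_add]; abel
      have h2 : (x + y).2 + j (m + n) = (x.2 + j m) + (y.2 + j n) := by
        simp only [Prod.snd_add, map_add]; abel
      rw [h1, h2]
      linarith [map_add_le_add p (x.1 - i m) (y.1 - i n), map_add_le_add q (x.2 + j m) (y.2 + j n)])
    (fun r x => by
      rw [Real.mul_iInf_of_nonneg (norm_nonneg r)]
      refine le_ciInf fun n => ?_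
      refine (ciInf_le (amalgam_bddBelow p q i j (r • x)) (r • n)).trans ?_
      rw [map_smul, map_smul, Prod.smul_fst, Prod.smul_snd, ← smul_sub, ← smul_add,
        map_smul_eq_mul, map_smul_eq_mul, mul_add])

variable (p : Seminorm 𝕜 U) (q : Seminorm 𝕜 U') (i : N →ₗ[𝕜] U) (j : N →ₗ[𝕜] U')

theorem amalgam_le (x : U × U') (n : N) :
    amalgam p q i j x ≤ p (x.1 - i n) + q (x.2 + j n) :=
  ciInf_le (amalgam_bddBelow p q i j x) n

theorem le_amalgam {x : U × U'} {C : ℝ} (h : ∀ n, C ≤ p (x.1 - i n) + q (x.2 + j n)) :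
    C ≤ amalgam p q i j x :=
  le_ciInf h

theorem amalgam_left_le (u : U) : amalgam p q i j (u, 0) ≤ p u :=
  (amalgam_le p q i j (u, 0) 0).trans (by simp)

theorem amalgam_right_le (u : U') : amalgam p q i j (0, u) ≤ q u :=
  (amalgam_le p q i j (0, u) 0).trans (by simp)

/-- By the triangle inequality, moving `i n` to the other side cannot lower the cost. Only one
inequality between the legs is needed, so the other leg may be a mere contraction; the proof of
1-separable injectivity depends on this. -/
theorem amalgam_left (h : ∀ n, p (i n) ≤ q (j n)) (u : U) : amalgam p q i j (u, 0) = p u := by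
  refine le_antisymm (amalgam_left_le p q i j u) (le_amalgam p q i j fun n => ?_)
  have h1 := map_add_le_add p (u - i n) (i n)
  rw [sub_add_cancel] at h1
  simpa using h1.trans (add_le_add le_rfl (h n))

theorem amalgam_right (h : ∀ n, q (j n) ≤ p (i n)) (u : U') : amalgam p q i j (0, u) = q u := by
  refine le_antisymm (amalgam_right_le p q i j u) (le_amalgam p q i j fun n => ?_)
  have h1 := map_sub_le_add q (u + j n) (j n)
  rw [add_sub_cancel_right] at h1
  have := h n
  simp only [zero_sub, map_neg_eq_map]
  linarith

theorem amalgam_glue (n : N) : amalgam p q i j (i n, -j n) = 0 :=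
  le_antisymm ((amalgam_le p q i j _ n).trans (by simp)) (apply_nonneg _ _)

/-- The universal property of the pushout: agreement on `N` makes the glued map insensitive to the
choice of representative. -/
theorem norm_add_le_amalgam {E : Type*} [NormedAddCommGroup E] [NormedSpace 𝕜 E]
    (r : U →ₗ[𝕜] E) (s : U' →ₗ[𝕜] E) (hr : ∀ u, ‖r u‖ ≤ p u) (hs : ∀ u, ‖s u‖ ≤ q u)
    (h : ∀ n, r (i n) = s (j n)) (x : U × U') : ‖r x.1 + s x.2‖ ≤ amalgam p q i j x := by
  refine le_amalgam p q i j fun n => ?_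
  have : r x.1 + s x.2 = r (x.1 - i n) + s (x.2 + j n) := by
    rw [map_sub, map_add, h]; abel
  rw [this]
  exact (norm_add_le _ _).trans (add_le_add (hr _) (hs _))

end Amalgam

/-! ### Separable seminorms and completions -/

section Model

variable {𝕜 : Type*} [RCLike 𝕜] {Q : Type*} [AddCommGroup Q] [Module 𝕜 Q]

/-- The seminorm `q` makes its space separable. -/
def SepSeminorm (q : Seminorm 𝕜 Q) : Prop :=
  ∃ d : ℕ → Q, ∀ x, ∀ ε > 0, ∃ n, q (x - d n) < ε

/-- The Hausdorff completion of a seminormed space. -/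
theorem Seminorm.exists_completion {Q : Type u} [AddCommGroup Q] [Module 𝕜 Q]
    (q : Seminorm 𝕜 Q) :
    ∃ (Z : Type u) (_ : NormedAddCommGroup Z) (_ : NormedSpace 𝕜 Z) (_ : CompleteSpace Z)
      (κ : Q →ₗ[𝕜] Z), (∀ x, ‖κ x‖ = q x) ∧ DenseRange κ := by
  let : SeminormedAddCommGroup Q := q.toAddGroupSeminorm.toSeminormedAddCommGroup
  let : NormedSpace 𝕜 Q := ⟨fun c x => (map_smul_eq_mul q c x).le⟩
  refine ⟨UniformSpace.Completion Q, inferInstance, inferInstance, inferInstance,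
    (UniformSpace.Completion.toComplₗᵢ (𝕜 := 𝕜) (E := Q)).toLinearMap, fun x => ?_, ?_⟩
  · exact (UniformSpace.Completion.toComplₗᵢ (𝕜 := 𝕜) (E := Q)).norm_map x
  · exact UniformSpace.Completion.denseRange_coe

/-- The Hausdorff completion of a seminormed space, realized in any given universe. -/
theorem Seminorm.exists_completion_of_coded (q : Seminorm 𝕜 Q) {Y : Type*} (hY : Coded Y)
    (d : Y → Q) (hd : ∀ x, ∀ ε > 0, ∃ y, q (x - d y) < ε) :
    ∃ (Z : Type u) (_ : NormedAddCommGroup Z) (_ : NormedSpace 𝕜 Z) (_ : CompleteSpace Z)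
      (κ : Q →ₗ[𝕜] Z), (∀ x, ‖κ x‖ = q x) ∧ DenseRange fun y => κ (d y) := by
  obtain ⟨Z, _, _, _, κ, hκ, hdense⟩ := q.exists_completion
  have hd' : DenseRange fun y => κ (d y) := by
    rw [Metric.denseRange_iff]
    intro z ε hε
    obtain ⟨x, hx⟩ := hdense.exists_dist_lt z (half_pos hε)
    obtain ⟨y, hy⟩ := hd x (ε / 2) (half_pos hε)
    refine ⟨y, ?_⟩
    rw [← hκ, map_sub, ← dist_eq_norm] at hy
    linarith [dist_triangle z (κ x) (κ (d y))]
  -- A metric space with a dense image of a coded set is itself coded, hence has a copy in every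
  -- universe.
  have : Small.{u} Z := (hY.of_denseRange _ hd').small
  let e : Shrink.{u} Z ≃ₗᵢ[𝕜] Z :=
    { Shrink.linearEquiv 𝕜 Z with norm_map' := fun x => rfl }
  have hc : CompleteSpace (Shrink.{u} Z) :=
    e.toIsometryEquiv.completeSpace
  refine ⟨Shrink.{u} Z, inferInstance, inferInstance, hc,
    e.symm.toLinearEquiv.toLinearMap ∘ₗ κ, fun x => ?_, ?_⟩
  · exact (e.symm.norm_map _).trans (hκ x)
  · exact e.symm.surjective.denseRange.comp hd' e.symm.continuous

theorem SepSeminorm.exists_completion.{v, w, w'} {𝕜 : Type w} [RCLike 𝕜] {Q : Type w'}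
    [AddCommGroup Q] [Module 𝕜 Q] {q : Seminorm 𝕜 Q} (hq : SepSeminorm q) :
    ∃ (Z : Type v) (_ : NormedAddCommGroup Z) (_ : NormedSpace 𝕜 Z) (_ : CompleteSpace Z)
      (_ : TopologicalSpace.SeparableSpace Z)
      (κ : Q →ₗ[𝕜] Z), (∀ x, ‖κ x‖ = q x) ∧ DenseRange κ := by
  obtain ⟨d, hd⟩ := hq
  obtain ⟨Z, i1, i2, i3, κ, hκ, hdense⟩ :=
    q.exists_completion_of_coded (Coded.of_countable ℕ) d hd
  refine ⟨Z, i1, i2, i3, ⟨Set.range fun y => κ (d y), Set.countable_range _, hdense⟩, κ, hκ, ?_⟩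
  exact hdense.mono (by rintro _ ⟨n, rfl⟩; exact ⟨d n, rfl⟩)

theorem SepSeminorm.of_separableSpace (X : Type*) [NormedAddCommGroup X] [NormedSpace 𝕜 X]
    [TopologicalSpace.SeparableSpace X] : SepSeminorm (normSeminorm 𝕜 X) := by
  refine ⟨TopologicalSpace.denseSeq X, fun x ε hε => ?_⟩
  obtain ⟨n, hn⟩ := (TopologicalSpace.denseRange_denseSeq X).exists_dist_lt x hε
  exact ⟨n, by simpa [dist_eq_norm] using hn⟩

theorem SepSeminorm.amalgam {U U' N : Type*} [AddCommGroup U] [Module 𝕜 U]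
    [AddCommGroup U'] [Module 𝕜 U'] [AddCommGroup N] [Module 𝕜 N]
    {p : Seminorm 𝕜 U} {q : Seminorm 𝕜 U'} (hp : SepSeminorm p) (hq : SepSeminorm q)
    (i : N →ₗ[𝕜] U) (j : N →ₗ[𝕜] U') : SepSeminorm (amalgam p q i j) := by
  obtain ⟨d, hd⟩ := hp
  obtain ⟨d', hd'⟩ := hq
  refine ⟨fun n => (d n.unpair.1, d' n.unpair.2), fun x ε hε => ?_⟩
  obtain ⟨m, hm⟩ := hd x.1 (ε / 2) (half_pos hε)
  obtain ⟨n, hn⟩ := hd' x.2 (ε / 2) (half_pos hε)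
  refine ⟨Nat.pair m n, ?_⟩
  refine (amalgam_le p q i j _ 0).trans_lt ?_
  simp only [Nat.unpair_pair, Prod.fst_sub, Prod.snd_sub, map_zero, sub_zero, add_zero]
  linarith

end Model

/-! ### Extension properties for seminormed spaces -/

section Extension

variable {𝕜 : Type*} [RCLike 𝕜] {Q N : Type*} [AddCommGroup Q] [Module 𝕜 Q]
  [AddCommGroup N] [Module 𝕜 N]

theorem denseRange_codRestrict_topologicalClosure {Z : Type*} [NormedAddCommGroup Z]
    [NormedSpace 𝕜 Z] (f : N →ₗ[𝕜] Z) :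
    DenseRange (f.codRestrict (LinearMap.range f).topologicalClosure fun n =>
      Submodule.le_topologicalClosure _ (LinearMap.mem_range_self _ n)) := by
  rw [Metric.denseRange_iff]
  rintro ⟨x, hx⟩ ε hε
  obtain ⟨_, ⟨n, rfl⟩, hn⟩ := Metric.mem_closure_iff.1 hx ε hε
  exact ⟨n, hn⟩

theorem norm_extendOfNorm_of_norm_eq {Z V : Type*} [NormedAddCommGroup Z] [NormedSpace 𝕜 Z]
    [NormedAddCommGroup V] [NormedSpace 𝕜 V] [CompleteSpace V] {f : N →ₗ[𝕜] V} {e : N →ₗ[𝕜] Z}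
    (he : DenseRange e) (h : ∀ n, ‖f n‖ = ‖e n‖) (x : Z) : ‖f.extendOfNorm e x‖ = ‖x‖ := by
  refine he.induction_on x (isClosed_eq (by fun_prop) (by fun_prop)) fun n => ?_
  rw [LinearMap.extendOfNorm_eq he ⟨1, fun n => by rw [one_mul, h]⟩, h]

/-- In a space of universal disposition, isometric maps extend along maps into separable
seminormed spaces. -/
theorem UniversalDispositionForSeparable.exists_extension {V : Type u} [NormedAddCommGroup V]
    [NormedSpace 𝕜 V] [CompleteSpace V] (hV : UniversalDispositionForSeparable 𝕜 V)
    {q : Seminorm 𝕜 Q} (hq : SepSeminorm q) (i : N →ₗ[𝕜] Q) (f : N →ₗ[𝕜] V)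
    (h : ∀ n, ‖f n‖ = q (i n)) :
    ∃ g : Q →ₗ[𝕜] V, (∀ x, ‖g x‖ = q x) ∧ ∀ n, g (i n) = f n := by
  obtain ⟨Z, _, _, _, _, κ, hκ, -⟩ := SepSeminorm.exists_completion.{u} hq
  -- The defining property needs a closed subspace of a Banach space: `f` factors through the image
  -- of `N` in the completion because it preserves seminorms, and extends to the closure by density.
  let X : Submodule 𝕜 Z := (LinearMap.range (κ ∘ₗ i)).topologicalClosure
  let e : N →ₗ[𝕜] X := (κ ∘ₗ i).codRestrict X fun n =>
    Submodule.le_topologicalClosure _ (LinearMap.mem_range_self _ n)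
  have he : DenseRange e := denseRange_codRestrict_topologicalClosure _
  have hnorm : ∀ n, ‖f n‖ = ‖e n‖ := fun n => by
    rw [h, ← hκ]; rfl
  have hb : ∃ C, ∀ n, ‖f n‖ ≤ C * ‖e n‖ := ⟨1, fun n => by rw [one_mul, hnorm]⟩
  have hiso := norm_extendOfNorm_of_norm_eq he hnorm
  obtain ⟨g, hg⟩ := hV Z X (Submodule.isClosed_topologicalClosure _)
    ⟨(f.extendOfNorm e).toLinearMap, hiso⟩
  refine ⟨g.toLinearMap ∘ₗ κ, fun x => (g.norm_map _).trans (hκ x), fun n => ?_⟩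
  exact (hg (e n)).trans (LinearMap.extendOfNorm_eq he hb n)

/-- Maps into a 1-separably injective space extend, with the same bound, along maps into
separable seminormed spaces. -/
theorem OneSeparablyInjective.exists_extension {E : Type u} [NormedAddCommGroup E]
    [NormedSpace 𝕜 E] [CompleteSpace E] (hE : OneSeparablyInjective 𝕜 E)
    {q : Seminorm 𝕜 Q} (hq : SepSeminorm q) (i : N →ₗ[𝕜] Q) (f : N →ₗ[𝕜] E)
    (h : ∀ n, ‖f n‖ ≤ q (i n)) :
    ∃ g : Q →ₗ[𝕜] E, (∀ x, ‖g x‖ ≤ q x) ∧ ∀ n, g (i n) = f n := by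
  obtain ⟨Z, _, _, _, _, κ, hκ, -⟩ := SepSeminorm.exists_completion.{u} hq
  let X : Submodule 𝕜 Z := (LinearMap.range (κ ∘ₗ i)).topologicalClosure
  let e : N →ₗ[𝕜] X := (κ ∘ₗ i).codRestrict X fun n =>
    Submodule.le_topologicalClosure _ (LinearMap.mem_range_self _ n)
  have he : DenseRange e := denseRange_codRestrict_topologicalClosure _
  have hb : ∀ n, ‖f n‖ ≤ 1 * ‖e n‖ := fun n => by
    rw [one_mul]
    exact (h n).trans (hκ _).ge
  obtain ⟨g, hg, hg'⟩ := hE Z X (Submodule.isClosed_topologicalClosure _) (f.extendOfNorm e)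
  have hg1 : ‖g‖ ≤ 1 := hg'.trans (LinearMap.opNorm_extendOfNorm_le he zero_le_one hb)
  refine ⟨g.toLinearMap ∘ₗ κ, fun x => ?_, fun n => ?_⟩
  · rw [← hκ]
    simpa using g.le_of_opNorm_le hg1 (κ x)
  · exact (hg (e n)).trans (LinearMap.extendOfNorm_eq he ⟨1, hb⟩ n)

end Extension

/-! ### Consequences of universal disposition -/

section Consequences

variable {𝕜 : Type*} [RCLike 𝕜] {V : Type u} [NormedAddCommGroup V] [NormedSpace 𝕜 V]

/-- Otherwise the identity of `V` extends to an isometry `g` of the ℓ¹-sum of `V` and `𝕜` into `V`.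
As `g` is already onto from `V`, it kills the vector `(-g (0, 1), 1)`, whose norm is at least 1. -/
theorem UniversalDispositionForSeparable.not_separableSpace [CompleteSpace V]
    (hV : UniversalDispositionForSeparable 𝕜 V) : ¬ TopologicalSpace.SeparableSpace V := by
  intro _
  have h𝕜 : TopologicalSpace.SeparableSpace 𝕜 := inferInstance
  have hq : SepSeminorm (amalgam (normSeminorm 𝕜 V) (normSeminorm 𝕜 𝕜) (0 : 𝕜 →ₗ[𝕜] V) 0) :=
    (SepSeminorm.of_separableSpace V).amalgam (SepSeminorm.of_separableSpace 𝕜) _ _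
  obtain ⟨g, hg, hg'⟩ := hV.exists_extension hq (LinearMap.inl 𝕜 V 𝕜) LinearMap.id
    (fun v => (amalgam_left (normSeminorm 𝕜 V) (normSeminorm 𝕜 𝕜) _ _ (fun _ => by simp) v).symm)
  have h1 : g (-g (0, 1), 1) = 0 := by
    have : ((-g (0, 1), 1) : V × 𝕜) = (0, 1) - LinearMap.inl 𝕜 V 𝕜 (g (0, 1)) := by simp
    rw [this, map_sub, hg']
    simp
  have h2 : (1 : ℝ) ≤ ‖g (-g (0, 1), 1)‖ := by
    rw [hg]
    exact le_amalgam _ _ _ _ fun n => by simp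
  rw [h1, norm_zero] at h2
  linarith

/-- Spaces of universal disposition for separable spaces are 1-separably injective. -/
theorem UniversalDispositionForSeparable.oneSeparablyInjective [CompleteSpace V]
    (hV : UniversalDispositionForSeparable 𝕜 V) : OneSeparablyInjective 𝕜 V := by
  intro Y _ _ _ _ X _ T
  have : TopologicalSpace.SeparableSpace X := inferInstance
  let R := LinearMap.range (T : X →ₗ[𝕜] V)
  let j : X →ₗ[𝕜] R := (T : X →ₗ[𝕜] V).rangeRestrict
  have hR : TopologicalSpace.SeparableSpace R := by
    have : DenseRange j := (LinearMap.surjective_rangeRestrict _).denseRange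
    exact this.separableSpace (T.continuous.subtype_mk _)
  -- Scaling the norm of `Y` by `‖T‖` makes `T` contractive; for `T = 0` this is only a seminorm,
  -- which the pushout allows.
  let c : NNReal := ‖T‖₊
  have hY : SepSeminorm (c • normSeminorm 𝕜 Y) := by
    refine ⟨TopologicalSpace.denseSeq Y, fun x ε hε => ?_⟩
    obtain ⟨n, hn⟩ := (TopologicalSpace.denseRange_denseSeq Y).exists_dist_lt x
      (show 0 < ε / (‖T‖ + 1) by positivity)
    refine ⟨n, ?_⟩
    rw [dist_eq_norm, lt_div_iff₀ (by positivity)] at hn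
    have : (c • normSeminorm 𝕜 Y) (x - TopologicalSpace.denseSeq Y n) =
      ‖T‖ * ‖x - TopologicalSpace.denseSeq Y n‖ := rfl
    rw [this]
    nlinarith [norm_nonneg (x - TopologicalSpace.denseSeq Y n)]
  have hle : ∀ x : X, ‖T x‖ ≤ ‖T‖ * ‖(x : Y)‖ := fun x => T.le_opNorm x
  -- `R` is isometric in this pushout, so its inclusion into `V` extends isometrically; the
  -- restriction to `Y` is the required operator.
  let q := amalgam (normSeminorm 𝕜 R) (c • normSeminorm 𝕜 Y) j X.subtype
  obtain ⟨g, hg, hg'⟩ := hV.exists_extension (q := q)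
    ((SepSeminorm.of_separableSpace R).amalgam hY _ _) (LinearMap.inl 𝕜 R Y) R.subtype
    (fun v => (amalgam_left (normSeminorm 𝕜 R) (c • normSeminorm 𝕜 Y) j _ hle v).symm)
  have hb : ∀ y, ‖(g ∘ₗ LinearMap.inr 𝕜 R Y) y‖ ≤ ‖T‖ * ‖y‖ := fun y => by
    rw [LinearMap.comp_apply, hg]
    exact amalgam_right_le _ _ _ _ y
  refine ⟨(g ∘ₗ LinearMap.inr 𝕜 R Y).mkContinuous ‖T‖ hb, fun x => ?_,
    LinearMap.mkContinuous_norm_le _ (norm_nonneg _) _⟩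
  have h0 : ‖g (j x, -X.subtype x)‖ = 0 := by
    rw [hg]
    exact amalgam_glue _ _ _ _ x
  have h1 : ((j x, -X.subtype x) : R × Y) =
    LinearMap.inl 𝕜 R Y (j x) - LinearMap.inr 𝕜 R Y (x : Y) := by simp
  rw [h1, map_sub, hg', norm_eq_zero, sub_eq_zero] at h0
  exact h0.symm

/-- 1-separable injectivity passes to 1-complemented subspaces. -/
theorem OneSeparablyInjective.of_isOneComplemented (hV : OneSeparablyInjective 𝕜 V)
    {F : Submodule 𝕜 V} (hF : IsOneComplemented F) {E : Type u} [NormedAddCommGroup E]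
    [NormedSpace 𝕜 E] (φ : E ≃ₗᵢ[𝕜] F) : OneSeparablyInjective 𝕜 E := by
  obtain ⟨P, hPP, hP1, rfl⟩ := hF
  intro Y _ _ _ _ X hX T
  let ι : E →ₗᵢ[𝕜] V := (Submodule.subtypeₗᵢ _).comp φ.toLinearIsometry
  obtain ⟨S, hS, hS'⟩ := hV Y X hX (ι.toContinuousLinearMap ∘L T)
  have hS1 : ‖S‖ ≤ ‖T‖ := hS'.trans (by
    refine ContinuousLinearMap.opNorm_le_bound _ (norm_nonneg _) fun x => ?_
    exact (ι.norm_map _).trans_le (T.le_opNorm x))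
  let P' : V →ₗ[𝕜] LinearMap.range (P : V →ₗ[𝕜] V) := (P : V →ₗ[𝕜] V).rangeRestrict
  let T' : Y →ₗ[𝕜] E := φ.symm.toLinearEquiv.toLinearMap ∘ₗ P' ∘ₗ (S : Y →ₗ[𝕜] V)
  have hT' : ∀ y, ‖T' y‖ ≤ ‖T‖ * ‖y‖ := fun y => by
    have h1 : ‖T' y‖ = ‖P (S y)‖ := φ.symm.norm_map _
    rw [h1]
    calc ‖P (S y)‖ ≤ 1 * ‖S y‖ := P.le_of_opNorm_le hP1 _
      _ ≤ ‖T‖ * ‖y‖ := by rw [one_mul]; exact S.le_of_opNorm_le hS1 _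
  refine ⟨T'.mkContinuous ‖T‖ hT', fun x => ?_, T'.mkContinuous_norm_le (norm_nonneg _) hT'⟩
  have h2 : P' (S x) = φ (T x) := by
    apply Subtype.ext
    obtain ⟨v, hv⟩ := (φ (T x)).2
    have h3 : S x = P v := (hS x).trans hv.symm
    change P (S x) = _
    rw [h3, ← ContinuousLinearMap.comp_apply, hPP]
    exact hv
  change φ.symm (P' (S x)) = T x
  rw [h2, φ.symm_apply_apply]

end Consequences

/-! ### Back-and-forth uniqueness -/

section Uniqueness

variable {𝕜 : Type*} [RCLike 𝕜] {V W : Type u} [NormedAddCommGroup V] [NormedSpace 𝕜 V]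
  [NormedAddCommGroup W] [NormedSpace 𝕜 W]

/-- The graphs of isometries between separable subspaces of `V` and of `W`. -/
def IsometryGraph (𝕜 : Type*) [RCLike 𝕜] (V W : Type u) [NormedAddCommGroup V] [NormedSpace 𝕜 V]
    [NormedAddCommGroup W] [NormedSpace 𝕜 W] : Type _ :=
  {G : Submodule 𝕜 (V × W) //
    TopologicalSpace.IsSeparable (G : Set (V × W)) ∧ ∀ x ∈ G, ‖x.1‖ = ‖x.2‖}

instance : PartialOrder (IsometryGraph 𝕜 V W) := Subtype.partialOrder _

theorem IsometryGraph.exists_upperBound (s : ℕ → IsometryGraph 𝕜 V W) (hs : Monotone s) :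
    ∃ b, ∀ n, s n ≤ b := by
  have hd : Directed (· ≤ ·) fun n => (s n).1 := Monotone.directed_le fun m n h => hs h
  refine ⟨⟨⨆ n, (s n).1, ?_, fun x hx => ?_⟩, fun n => le_iSup (fun n => (s n).1) n⟩
  · rw [Submodule.coe_iSup_of_directed _ hd]
    exact TopologicalSpace.IsSeparable.iUnion fun n => (s n).2.1
  · obtain ⟨n, hn⟩ := (Submodule.mem_iSup_of_directed _ hd).1 hx
    exact (s n).2.2 x hn

/-- Exchanging the two spaces. -/
def IsometryGraph.swap (G : IsometryGraph 𝕜 V W) : IsometryGraph 𝕜 W V :=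
  ⟨G.1.comap (LinearEquiv.prodComm 𝕜 W V).toLinearMap, by
    refine ⟨?_, fun x hx => (G.2.2 (x.2, x.1) hx).symm⟩
    have := G.2.1.image (continuous_swap (X := V) (Y := W))
    refine this.mono ?_
    rintro ⟨w, v⟩ h
    exact ⟨(v, w), h, rfl⟩⟩

/-- The graph itself serves as the common part: its first projection is an isometric map into the
separable span `Q` of the old domain and `v`, and its second projection, isometric into `W`, extends
over `Q`. -/
theorem IsometryGraph.exists_extension_left [CompleteSpace W]
    (hW : UniversalDispositionForSeparable 𝕜 W) (G : IsometryGraph 𝕜 V W) (v : V) :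
    ∃ G' : IsometryGraph 𝕜 V W, G ≤ G' ∧ ∃ w, (v, w) ∈ G'.1 := by
  let Q : Submodule 𝕜 V := G.1.map (LinearMap.fst 𝕜 V W) ⊔ 𝕜 ∙ v
  have hQs : TopologicalSpace.IsSeparable (Q : Set V) := by
    have h1 : TopologicalSpace.IsSeparable (Prod.fst '' (G.1 : Set (V × W)) ∪ {v}) :=
      (G.2.1.image continuous_fst).union (Set.countable_singleton v).isSeparable
    refine (h1.span (R := 𝕜)).mono ?_
    rw [SetLike.coe_subset_coe]
    refine sup_le ?_ ?_
    · rintro _ ⟨x, hx, rfl⟩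
      exact Submodule.subset_span (Or.inl ⟨x, hx, rfl⟩)
    · exact Submodule.span_mono Set.subset_union_right
  have : TopologicalSpace.SeparableSpace Q := hQs.separableSpace
  let i : G.1 →ₗ[𝕜] Q := (LinearMap.fst 𝕜 V W ∘ₗ G.1.subtype).codRestrict Q fun x =>
    Submodule.mem_sup_left ⟨x, x.2, rfl⟩
  obtain ⟨g, hg, hg'⟩ := hW.exists_extension (SepSeminorm.of_separableSpace (𝕜 := 𝕜) Q) i
    (LinearMap.snd 𝕜 V W ∘ₗ G.1.subtype) (fun x => (G.2.2 x x.2).symm)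
  let γ : Q →ₗ[𝕜] V × W := Q.subtype.prod g
  have hgc : Continuous g :=
    AddMonoidHomClass.continuous_of_bound g 1 fun x => by rw [one_mul, hg]; rfl
  refine ⟨⟨LinearMap.range γ, ?_, ?_⟩, ?_, g ⟨v, Submodule.mem_sup_right
    (Submodule.mem_span_singleton_self v)⟩, ⟨v, _⟩, rfl⟩
  · have hγ : Continuous γ := continuous_subtype_val.prodMk hgc
    rw [LinearMap.coe_range]
    exact TopologicalSpace.isSeparable_range hγ
  · rintro _ ⟨x, rfl⟩
    exact (hg x).symm
  · intro x hx
    exact ⟨i ⟨x, hx⟩, Prod.ext rfl (hg' ⟨x, hx⟩)⟩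

theorem IsometryGraph.exists_extension_right [CompleteSpace V]
    (hV : UniversalDispositionForSeparable 𝕜 V) (G : IsometryGraph 𝕜 V W) (w : W) :
    ∃ G' : IsometryGraph 𝕜 V W, G ≤ G' ∧ ∃ v, (v, w) ∈ G'.1 := by
  obtain ⟨G', h, v, hv⟩ := G.swap.exists_extension_left hV w
  exact ⟨G'.swap, fun x hx => @h (x.2, x.1) hx, v, hv⟩

/-- An isometric relation between Banach spaces with dense projections is the graph, up to
closure, of an isometry. -/
theorem nonempty_linearIsometryEquiv_of_graph [CompleteSpace V] [CompleteSpace W]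
    (G : Submodule 𝕜 (V × W)) (hG : ∀ x ∈ G, ‖x.1‖ = ‖x.2‖)
    (hV : DenseRange fun x : G => x.1.1) (hW : DenseRange fun x : G => x.1.2) :
    Nonempty (V ≃ₗᵢ[𝕜] W) :=
  ⟨LinearEquiv.extendOfIsometry (LinearEquiv.refl 𝕜 G) (LinearMap.fst 𝕜 V W ∘ₗ G.subtype)
    (LinearMap.snd 𝕜 V W ∘ₗ G.subtype) hV hW fun x => (hG x x.2).symm⟩

/-- The tasks are the points of dense sets on both sides, each to be put into the domain or the
range. They are always applicable, and the union of the chain has dense projections. -/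
theorem UniversalDispositionForSeparable.nonempty_linearIsometryEquiv [CompleteSpace V]
    [CompleteSpace W] (CH : continuum.{0} = aleph 1)
    (hVd : density V = aleph 1) (hV : UniversalDispositionForSeparable 𝕜 V)
    (hWd : density W = aleph 1) (hW : UniversalDispositionForSeparable 𝕜 W) :
    Nonempty (V ≃ₗᵢ[𝕜] W) := by
  obtain ⟨s, hs, hs'⟩ := exists_dense_mk_eq_density V
  obtain ⟨t, ht, ht'⟩ := exists_dense_mk_eq_density W
  have hsc : Coded s := Coded.of_mk_le_continuum (by rw [hs', hVd, continuum_eq_aleph_one CH])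
  have htc : Coded t := Coded.of_mk_le_continuum (by rw [ht', hWd, continuum_eq_aleph_one CH])
  obtain ⟨I, _, _, _, hI, hIc, -⟩ := exists_omega_one_order
  have : Nonempty s := by
    rw [← mk_ne_zero_iff, hs', hVd]
    exact (aleph_pos 1).ne'
  obtain ⟨τ, hτ⟩ := (hsc.sum htc).exists_surjective CH hI
  let p₀ : IsometryGraph 𝕜 V W := ⟨⊥, by
    simpa using (Set.countable_singleton (0 : V × W)).isSeparable, by simp⟩
  obtain ⟨c, hc, hc'⟩ := exists_generic_chain p₀ IsometryGraph.exists_upperBound hIc τ hτ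
    (fun _ _ => True)
    (fun x G => Sum.elim (fun v : s => ∃ w, ((v : V), w) ∈ G.1)
      (fun w : t => ∃ v, (v, (w : W)) ∈ G.1) x) (by
    rintro (v | w) G -
    · exact G.exists_extension_left hW v
    · exact G.exists_extension_right hV w)
  have hd : Directed (· ≤ ·) fun i => (c i).1 := Monotone.directed_le fun _ _ h => hc h
  have i₀ : I := Classical.arbitrary I
  refine nonempty_linearIsometryEquiv_of_graph (⨆ i, (c i).1) (fun x hx => ?_) ?_ ?_
  · obtain ⟨i, hi⟩ := (Submodule.mem_iSup_of_directed _ hd).1 hx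
    exact (c i).2.2 x hi
  · refine hs.mono fun v hv => ?_
    obtain ⟨j, w, hw⟩ := hc' (Sum.inl ⟨v, hv⟩) ⟨i₀, fun _ _ => trivial⟩
    exact ⟨⟨(v, w), le_iSup (fun i => (c i).1) j hw⟩, rfl⟩
  · refine ht.mono fun w hw => ?_
    obtain ⟨j, v, hv⟩ := hc' (Sum.inr ⟨w, hw⟩) ⟨i₀, fun _ _ => trivial⟩
    exact ⟨⟨(v, w), le_iSup (fun i => (c i).1) j hv⟩, rfl⟩

end Uniqueness

/-! ### Seminorms on countably generated free spaces -/

section FreeSpace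

variable (𝕜 : Type*) [RCLike 𝕜]

/-- One sequence serves all seminorms at once: finite combinations of basis vectors with
coefficients from a dense sequence of scalars, since every seminorm is continuous along each basis
line. -/
theorem exists_seq_dense_finsupp :
    ∃ d : ℕ → (ℕ →₀ 𝕜), ∀ q : Seminorm 𝕜 (ℕ →₀ 𝕜), ∀ x, ∀ ε > 0, ∃ n, q (x - d n) < ε := by
  let D : List (ℕ × ℕ) → (ℕ →₀ 𝕜) := fun l =>
    (l.map fun k => Finsupp.single k.1 (TopologicalSpace.denseSeq 𝕜 k.2)).sum
  obtain ⟨φ, hφ⟩ := exists_surjective_nat (List (ℕ × ℕ))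
  suffices h : ∀ q : Seminorm 𝕜 (ℕ →₀ 𝕜), ∀ x, ∀ ε > 0, ∃ l, q (x - D l) < ε by
    refine ⟨D ∘ φ, fun q x ε hε => ?_⟩
    obtain ⟨l, hl⟩ := h q x ε hε
    obtain ⟨n, rfl⟩ := hφ l
    exact ⟨n, hl⟩
  intro q x
  induction x using Finsupp.induction_linear with
  | zero => exact fun ε hε => ⟨[], by simpa [D] using hε⟩
  | add x y hx hy =>
    intro ε hε
    obtain ⟨l, hl⟩ := hx (ε / 2) (half_pos hε)
    obtain ⟨m, hm⟩ := hy (ε / 2) (half_pos hε)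
    refine ⟨l ++ m, ?_⟩
    have : x + y - D (l ++ m) = (x - D l) + (y - D m) := by
      simp only [D, List.map_append, List.sum_append]; abel
    rw [this]
    linarith [map_add_le_add q (x - D l) (y - D m)]
  | single n c =>
    intro ε hε
    obtain ⟨k, hk⟩ := (TopologicalSpace.denseRange_denseSeq 𝕜).exists_dist_lt c
      (show 0 < ε / (q (Finsupp.single n 1) + 1) by positivity)
    refine ⟨[(n, k)], ?_⟩
    have : Finsupp.single n c - D [(n, k)] =
        (c - TopologicalSpace.denseSeq 𝕜 k) • Finsupp.single n (1 : 𝕜) := by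
      simp [D]
    rw [this, map_smul_eq_mul, ← dist_eq_norm]
    rw [lt_div_iff₀ (by positivity)] at hk
    nlinarith [dist_nonneg (x := c) (y := TopologicalSpace.denseSeq 𝕜 k)]

theorem exists_seq_dense_finsupp_prod :
    ∃ d : ℕ → (ℕ →₀ 𝕜) × (ℕ →₀ 𝕜), ∀ q : Seminorm 𝕜 ((ℕ →₀ 𝕜) × (ℕ →₀ 𝕜)),
      ∀ x, ∀ ε > 0, ∃ n, q (x - d n) < ε := by
  obtain ⟨d, hd⟩ := exists_seq_dense_finsupp 𝕜
  refine ⟨fun n => (d n.unpair.1, d n.unpair.2), fun q x ε hε => ?_⟩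
  obtain ⟨m, hm⟩ := hd (q.comp (LinearMap.inl 𝕜 _ _)) x.1 (ε / 2) (half_pos hε)
  obtain ⟨n, hn⟩ := hd (q.comp (LinearMap.inr 𝕜 _ _)) x.2 (ε / 2) (half_pos hε)
  refine ⟨Nat.pair m n, ?_⟩
  simp only [Nat.unpair_pair]
  rw [Seminorm.comp_apply] at hm hn
  have : x - (d m, d n) = LinearMap.inl 𝕜 _ _ (x.1 - d m) + LinearMap.inr 𝕜 _ _ (x.2 - d n) := by
    ext <;> simp
  rw [this]
  exact (map_add_le_add q _ _).trans_lt (by linarith)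

theorem SepSeminorm.finsupp_prod (q : Seminorm 𝕜 ((ℕ →₀ 𝕜) × (ℕ →₀ 𝕜))) : SepSeminorm q :=
  let ⟨d, hd⟩ := exists_seq_dense_finsupp_prod 𝕜
  ⟨d, hd q⟩

theorem Coded.seminorm_finsupp_prod : Coded (Seminorm 𝕜 ((ℕ →₀ 𝕜) × (ℕ →₀ 𝕜))) := by
  obtain ⟨d, hd⟩ := exists_seq_dense_finsupp_prod 𝕜
  refine Coded.real.seq.of_injective (fun q n => q (d n)) fun q q' h => Seminorm.ext fun x => ?_
  refine eq_of_forall_dist_le fun ε hε => ?_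
  -- The sum of the seminorms makes a single approximant good for both.
  obtain ⟨n, hn⟩ := hd (q + q') x ε hε
  have h1 : q (d n) = q' (d n) := congrFun h n
  have h2 := abs_sub_map_le_sub q x (d n)
  have h3 := abs_sub_map_le_sub q' x (d n)
  rw [add_apply] at hn
  rw [Real.dist_eq, abs_le]
  rw [abs_le] at h2 h3
  constructor <;> linarith

theorem Coded.finsupp_linearMap {M : Type*} [AddCommGroup M] [Module 𝕜 M] (hM : Coded M) :
    Coded ((ℕ →₀ 𝕜) →ₗ[𝕜] M) := by
  refine hM.seq.of_injective (fun f n => f (Finsupp.single n 1)) fun f g h => ?_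
  refine Finsupp.lhom_ext' fun n => LinearMap.ext_ring ?_
  exact congrFun h n

end FreeSpace

theorem Finsupp.prod_ext_apply {E α 𝕜 : Type*} [Zero 𝕜] {m n : E × (α →₀ 𝕜)} (h1 : m.1 = n.1)
    (h2 : ∀ x, m.2 x = n.2 x) : m = n :=
  Prod.ext h1 (Finsupp.ext h2)

/-! ### Coordinate projections -/

section Projection

variable (𝕜 : Type*) [RCLike 𝕜] (E : Type*) [NormedAddCommGroup E] [NormedSpace 𝕜 E]

open Classical in
/-- The projection of `E × (ℝ →₀ 𝕜)` that forgets the coordinates outside `A`. -/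
noncomputable def coordProj (A : Set ℝ) : E × (ℝ →₀ 𝕜) →ₗ[𝕜] E × (ℝ →₀ 𝕜) :=
  LinearMap.id.prodMap ((Finsupp.supported 𝕜 𝕜 A).subtype ∘ₗ Finsupp.restrictDom 𝕜 𝕜 A)

variable {𝕜 E}

open Classical in
theorem coordProj_snd (A : Set ℝ) (m : E × (ℝ →₀ 𝕜)) (x : ℝ) :
    (coordProj 𝕜 E A m).2 x = if x ∈ A then m.2 x else 0 := by
  simp [coordProj, Finsupp.filter_apply]

theorem coordProj_inl (A : Set ℝ) (e : E) : coordProj 𝕜 E A (e, 0) = (e, 0) := by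
  classical
  refine Finsupp.prod_ext_apply rfl fun x => ?_
  rw [coordProj_snd]
  simp

theorem coordProj_coordProj_of_subset {A B : Set ℝ} (h : A ⊆ B) (m : E × (ℝ →₀ 𝕜)) :
    coordProj 𝕜 E A (coordProj 𝕜 E B m) = coordProj 𝕜 E A m := by
  classical
  refine Finsupp.prod_ext_apply rfl fun x => ?_
  simp only [coordProj_snd]
  grind

theorem coordProj_coordProj_of_superset {A B : Set ℝ} (h : A ⊆ B) (m : E × (ℝ →₀ 𝕜)) :
    coordProj 𝕜 E B (coordProj 𝕜 E A m) = coordProj 𝕜 E A m := by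
  classical
  refine Finsupp.prod_ext_apply rfl fun x => ?_
  simp only [coordProj_snd]
  grind

theorem coordProj_eq_self_mono {A B : Set ℝ} (h : A ⊆ B) {m : E × (ℝ →₀ 𝕜)}
    (hm : coordProj 𝕜 E A m = m) : coordProj 𝕜 E B m = m := by
  rw [← hm, coordProj_coordProj_of_superset h]

-- Only the finitely many coordinates in the support of `m` matter, and membership of each in the
-- increasing sets stabilizes.
open Filter in
theorem eventually_coordProj_eq {ι : Type*} [SemilatticeSup ι] [Nonempty ι] {A : ι → Set ℝ}
    (hA : Monotone A) (m : E × (ℝ →₀ 𝕜)) :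
    ∀ᶠ i in atTop, coordProj 𝕜 E (A i) m = coordProj 𝕜 E (⋃ i, A i) m := by
  classical
  have h1 : ∀ x ∈ m.2.support, ∀ᶠ i in atTop, (x ∈ A i ↔ x ∈ ⋃ i, A i) := by
    intro x _
    by_cases hx : x ∈ ⋃ i, A i
    · obtain ⟨i₀, hi₀⟩ := Set.mem_iUnion.1 hx
      filter_upwards [eventually_ge_atTop i₀] with i hi
      exact ⟨fun _ => hx, fun _ => hA hi hi₀⟩
    · exact Eventually.of_forall fun i => ⟨fun h => Set.mem_iUnion.2 ⟨i, h⟩, fun h => absurd h hx⟩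
  filter_upwards [(Finset.eventually_all m.2.support).2 h1] with i hi
  refine Finsupp.prod_ext_apply rfl fun x => ?_
  simp only [coordProj_snd]
  by_cases hx : x ∈ m.2.support
  · simp only [hi x hx]
  · rw [Finsupp.notMem_support_iff.1 hx]
    simp

end Projection

/-! ### Extensions of `E` with a contractive retraction -/

section Stage

variable (𝕜 : Type*) [RCLike 𝕜] (E : Type*) [NormedAddCommGroup E] [NormedSpace 𝕜 E]

/-- A separable extension of `E` with a contractive retraction onto `E`: a countable set of new
generators, a seminorm, and a retraction. Only the values on elements with coordinates in `supp`
matter. -/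
structure Stage where
  /-- the set of generators in use -/
  supp : Set ℝ
  countable_supp : supp.Countable
  /-- the seminorm -/
  seminorm : Seminorm 𝕜 (E × (ℝ →₀ 𝕜))
  /-- the retraction -/
  ret : E × (ℝ →₀ 𝕜) →ₗ[𝕜] E
  norm_ret_le : ∀ m, ‖ret m‖ ≤ seminorm m
  seminorm_inl : ∀ e, seminorm (e, 0) = ‖e‖
  ret_inl : ∀ e, ret (e, 0) = e

variable {𝕜 E}

/-- Values are compared only on vectors supported in the smaller stage. Antisymmetry fails, because
data off the support are arbitrary. -/
instance : Preorder (Stage 𝕜 E) where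
  le s t := s.supp ⊆ t.supp ∧ ∀ m, t.seminorm (coordProj 𝕜 E s.supp m) =
    s.seminorm (coordProj 𝕜 E s.supp m) ∧
      t.ret (coordProj 𝕜 E s.supp m) = s.ret (coordProj 𝕜 E s.supp m)
  le_refl s := ⟨subset_rfl, fun _ => ⟨rfl, rfl⟩⟩
  le_trans s t r hst htr := by
    refine ⟨hst.1.trans htr.1, fun m => ?_⟩
    have := htr.2 (coordProj 𝕜 E s.supp m)
    rw [coordProj_coordProj_of_superset hst.1] at this
    exact ⟨this.1.trans (hst.2 m).1, this.2.trans (hst.2 m).2⟩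

theorem Stage.supp_mono : Monotone (Stage.supp : Stage 𝕜 E → Set ℝ) := fun _ _ h => h.1

theorem Stage.seminorm_eq_of_le {s t : Stage 𝕜 E} (h : s ≤ t) {m : E × (ℝ →₀ 𝕜)}
    (hm : coordProj 𝕜 E s.supp m = m) : t.seminorm m = s.seminorm m := by
  have := (h.2 m).1
  rwa [hm] at this

open Filter in
/-- The limit of a chain of stages. -/
theorem Stage.exists_limit {ι : Type*} [SemilatticeSup ι] [Nonempty ι] {c : ι → Stage 𝕜 E}
    (hc : Monotone c) :
    ∃ (p : Seminorm 𝕜 (E × (ℝ →₀ 𝕜))) (r : E × (ℝ →₀ 𝕜) →ₗ[𝕜] E), ∀ m, ∀ᶠ i in atTop,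
      p m = (c i).seminorm (coordProj 𝕜 E (c i).supp m) ∧
        r m = (c i).ret (coordProj 𝕜 E (c i).supp m) := by
  have hA : Monotone fun i => (c i).supp := Stage.supp_mono.comp hc
  -- The projection of `m` is eventually constant, and the order freezes the values at vectors
  -- supported in an earlier stage.
  have h : ∀ m, ∃ (a : ℝ) (e : E), ∀ᶠ i in atTop,
      a = (c i).seminorm (coordProj 𝕜 E (c i).supp m) ∧
        e = (c i).ret (coordProj 𝕜 E (c i).supp m) := by
    intro m
    obtain ⟨i₀, hi₀⟩ := eventually_atTop.1 (eventually_coordProj_eq hA m)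
    refine ⟨(c i₀).seminorm (coordProj 𝕜 E (c i₀).supp m),
      (c i₀).ret (coordProj 𝕜 E (c i₀).supp m), ?_⟩
    filter_upwards [eventually_ge_atTop i₀] with i hi
    have h1 := (hc hi).2 m
    rw [(hi₀ i hi).trans (hi₀ i₀ le_rfl).symm]
    exact ⟨h1.1.symm, h1.2.symm⟩
  choose p r hpr using h
  refine ⟨Seminorm.of p (fun x y => ?_) (fun a x => ?_),
    { toFun := r, map_add' := fun x y => ?_, map_smul' := fun a x => ?_ }, hpr⟩
  · obtain ⟨i, hx, hy, hxy⟩ := ((hpr x).and ((hpr y).and (hpr (x + y)))).exists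
    rw [hx.1, hy.1, hxy.1, map_add]
    exact map_add_le_add _ _ _
  · obtain ⟨i, hx, hax⟩ := ((hpr x).and (hpr (a • x))).exists
    rw [hx.1, hax.1, map_smul, map_smul_eq_mul]
  · obtain ⟨i, hx, hy, hxy⟩ := ((hpr x).and ((hpr y).and (hpr (x + y)))).exists
    rw [hx.2, hy.2, hxy.2, map_add, map_add]
  · obtain ⟨i, hx, hax⟩ := ((hpr x).and (hpr (a • x))).exists
    rw [hx.2, hax.2, map_smul, map_smul, RingHom.id_apply]

open Filter in
theorem Stage.exists_upperBound (c : ℕ → Stage 𝕜 E) (hc : Monotone c) : ∃ b, ∀ n, c n ≤ b := by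
  obtain ⟨p, r, hpr⟩ := Stage.exists_limit hc
  refine ⟨⟨⋃ n, (c n).supp, Set.countable_iUnion fun n => (c n).countable_supp, p, r,
    fun m => ?_, fun e => ?_, fun e => ?_⟩,
    fun n => ⟨Set.subset_iUnion (fun n => (c n).supp) n, fun m => ?_⟩⟩
  · obtain ⟨i, hi⟩ := (hpr m).exists
    rw [hi.1, hi.2]
    exact (c i).norm_ret_le _
  · obtain ⟨i, hi⟩ := (hpr (e, 0)).exists
    rw [hi.1, coordProj_inl, (c i).seminorm_inl]
  · obtain ⟨i, hi⟩ := (hpr (e, 0)).exists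
    rw [hi.2, coordProj_inl, (c i).ret_inl]
  · obtain ⟨i, hi, hni⟩ :=
      ((hpr (coordProj 𝕜 E (c n).supp m)).and (eventually_ge_atTop n)).exists
    simp only
    rw [hi.1, hi.2, coordProj_coordProj_of_superset (hc hni).1]
    exact (hc hni).2 m

/-- A countably generated subspace of a stage can be enlarged in any prescribed countably generated
way inside a larger stage. -/
theorem Stage.exists_extension {E : Type u} [NormedAddCommGroup E] [NormedSpace 𝕜 E]
    [CompleteSpace E] (hE : OneSeparablyInjective 𝕜 E) (s : Stage 𝕜 E)
    (i : (ℕ →₀ 𝕜) →ₗ[𝕜] E × (ℝ →₀ 𝕜)) (hi : ∀ n, coordProj 𝕜 E s.supp (i n) = i n)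
    (q : Seminorm 𝕜 ((ℕ →₀ 𝕜) × (ℕ →₀ 𝕜))) (hq : ∀ n, s.seminorm (i n) = q (n, 0)) :
    ∃ t, s ≤ t ∧ ∃ h : (ℕ →₀ 𝕜) →ₗ[𝕜] E × (ℝ →₀ 𝕜), ∀ a b,
      coordProj 𝕜 E t.supp (i a + h b) = i a + h b ∧ t.seminorm (i a + h b) = q (a, b) := by
  classical
  -- Injectivity of `E` enters here: the retraction, transported along `i`, extends to the
  -- prescribed extension with bound `q`.
  obtain ⟨σ, hσ, hσi⟩ := hE.exists_extension (SepSeminorm.finsupp_prod 𝕜 q)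
    (LinearMap.inl 𝕜 (ℕ →₀ 𝕜) (ℕ →₀ 𝕜)) (s.ret ∘ₗ i)
    (fun n => (s.norm_ret_le _).trans_eq (hq n))
  -- Countably many fresh generators are available since `ℝ` is uncountable.
  have hinf : (s.suppᶜ).Infinite := fun hfin => by
    have := s.countable_supp.union hfin.countable
    rw [Set.union_compl_self] at this
    exact Set.not_countable_univ this
  let ω : ℕ → ℝ := fun n => hinf.natEmbedding _ n
  have hω : Function.Injective ω := Subtype.val_injective.comp (hinf.natEmbedding _).injective
  have hωs : ∀ n, ω n ∉ s.supp := fun n => (hinf.natEmbedding _ n).2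
  let κ : E × (ℝ →₀ 𝕜) →ₗ[𝕜] (ℕ →₀ 𝕜) := Finsupp.lcomapDomain ω hω ∘ₗ LinearMap.snd 𝕜 _ _
  let h : (ℕ →₀ 𝕜) →ₗ[𝕜] E × (ℝ →₀ 𝕜) := LinearMap.inr 𝕜 _ _ ∘ₗ Finsupp.lmapDomain 𝕜 𝕜 ω
  have hκ : ∀ m n, κ m n = m.2 (ω n) := fun _ _ => rfl
  have hκh : ∀ b, κ (h b) = b := fun b => by
    ext n
    exact Finsupp.mapDomain_apply hω b n
  have hκs : ∀ m, coordProj 𝕜 E s.supp m = m → κ m = 0 := fun m hm => by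
    ext n
    rw [hκ, ← hm, coordProj_snd, if_neg (hωs n), Finsupp.zero_apply]
  have hh : ∀ b x, x ∉ Set.range ω → (h b).2 x = 0 := fun b x hx =>
    Finsupp.mapDomain_of_notMem_range b x hx
  have hhs : ∀ b, coordProj 𝕜 E s.supp (h b) = 0 := fun b => by
    refine Finsupp.prod_ext_apply rfl fun x => ?_
    rw [coordProj_snd]
    split_ifs with hx
    · exact hh b x (by rintro ⟨n, rfl⟩; exact hωs n hx)
    · rfl
  let ρ : E × (ℝ →₀ 𝕜) →ₗ[𝕜] (ℕ →₀ 𝕜) × (ℕ →₀ 𝕜) := LinearMap.inr 𝕜 _ _ ∘ₗ κ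
  -- The new stage carries the pushout of the old one and `q`, pulled back by splitting a vector
  -- into its old part and the part on the fresh generators.
  let p := amalgam s.seminorm q i (LinearMap.inl 𝕜 (ℕ →₀ 𝕜) (ℕ →₀ 𝕜))
  have hp : ∀ m, p (m, 0) = s.seminorm m :=
    amalgam_left s.seminorm q i (LinearMap.inl 𝕜 _ _) fun n => (hq n).le
  have hglue : ∀ m, coordProj 𝕜 E s.supp m = m →
      (coordProj 𝕜 E s.supp).prod ρ m = (m, 0) := fun m hm => by
    simp [ρ, hκs m hm, hm]
  let t : Stage 𝕜 E :=
    { supp := s.supp ∪ Set.range ω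
      countable_supp := s.countable_supp.union (Set.countable_range ω)
      seminorm := p.comp ((coordProj 𝕜 E s.supp).prod ρ)
      ret := s.ret ∘ₗ coordProj 𝕜 E s.supp + σ ∘ₗ ρ
      norm_ret_le := fun m => norm_add_le_amalgam _ _ _ _ s.ret σ s.norm_ret_le hσ
        (fun n => (hσi n).symm) ((coordProj 𝕜 E s.supp).prod ρ m)
      seminorm_inl := fun e => by
        rw [Seminorm.comp_apply, hglue _ (coordProj_inl _ _), hp, s.seminorm_inl]
      ret_inl := fun e => by
        simp [ρ, hκs _ (coordProj_inl _ e), coordProj_inl, s.ret_inl]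
        exact σ.map_zero }
  refine ⟨t, ⟨Set.subset_union_left, fun m => ⟨?_, ?_⟩⟩, h, fun a b => ⟨?_, ?_⟩⟩
  · have := coordProj_coordProj_of_superset (subset_refl s.supp) m
    exact (congrArg p (hglue _ this)).trans (hp _)
  · have := coordProj_coordProj_of_superset (subset_refl s.supp) m
    simp [t, ρ, hκs _ this, this]
    exact σ.map_zero
  · rw [map_add, coordProj_eq_self_mono (Set.subset_union_left : s.supp ⊆ t.supp) (hi a)]
    congr 1
    refine Finsupp.prod_ext_apply rfl fun x => ?_
    rw [coordProj_snd]
    split_ifs with hx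
    · rfl
    · exact (hh b x fun hx' => hx (Or.inr hx')).symm
  · have h1 : (coordProj 𝕜 E s.supp).prod ρ (i a + h b) = (i a, (0, b)) := by
      simp [ρ, hi, hhs, hκh, hκs _ (hi a)]
    have h2 : t.seminorm (i a + h b) = p (i a, (0, b)) := congrArg p h1
    rw [h2]
    -- The choice `n = a` gives the upper bound; any other `n` costs `q (a - n, 0) + q (n, b)`, at
    -- least `q (a, b)`.
    refine le_antisymm ((amalgam_le _ _ _ _ _ a).trans (by simp)) (le_amalgam _ _ _ _ fun n => ?_)
    simp only
    rw [← map_sub, hq]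
    have h3 : (a, b) = (a - n, 0) + ((0, b) + LinearMap.inl 𝕜 (ℕ →₀ 𝕜) (ℕ →₀ 𝕜) n) := by simp
    exact (congrArg q h3).trans_le (map_add_le_add q _ _)

/-- The trivial stage. -/
noncomputable def Stage.initial : Stage 𝕜 E where
  supp := ∅
  countable_supp := Set.countable_empty
  seminorm := (normSeminorm 𝕜 E).comp (LinearMap.fst 𝕜 E (ℝ →₀ 𝕜))
  ret := LinearMap.fst 𝕜 E (ℝ →₀ 𝕜)
  norm_ret_le _ := le_rfl
  seminorm_inl _ := rfl
  ret_inl _ := rfl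

end Stage

/-! ### Existence and complemented embeddings -/

section Existence

variable {𝕜 : Type*} [RCLike 𝕜]

/-- The space spanned, up to closure, by a seminormed space `M` is of universal disposition for
separable spaces as soon as every one-step extension of a countably generated part of `M` is
realized in `M`. -/
theorem universalDispositionForSeparable_of_realizes {M : Type*} [AddCommGroup M] [Module 𝕜 M]
    {V : Type u} [NormedAddCommGroup V] [NormedSpace 𝕜 V] [CompleteSpace V] (κ : M →ₗ[𝕜] V)
    (hκ : DenseRange κ)
    (h : ∀ m : ℕ → M, ∃ i : (ℕ →₀ 𝕜) →ₗ[𝕜] M, (∀ n, κ (i (Finsupp.single n 1)) = κ (m n)) ∧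
      ∀ q : Seminorm 𝕜 ((ℕ →₀ 𝕜) × (ℕ →₀ 𝕜)), (∀ a, ‖κ (i a)‖ = q (a, 0)) →
        ∃ k : (ℕ →₀ 𝕜) →ₗ[𝕜] M, ∀ a b, ‖κ (i a + k b)‖ = q (a, b)) :
    UniversalDispositionForSeparable 𝕜 V := by
  intro Y _ _ _ _ X _ f
  let x := TopologicalSpace.denseSeq X
  have hm : ∀ n l : ℕ, ∃ m, dist (f (x n)) (κ m) < 1 / ((l : ℝ) + 1) := fun n l =>
    hκ.exists_dist_lt _ (by positivity)
  choose m hm using hm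
  obtain ⟨i, him, hi⟩ := h fun n => m n.unpair.1 n.unpair.2
  have happrox : ∀ z : X, ∀ ε > 0, ∃ a, ‖f z - κ (i a)‖ < ε := by
    intro z ε hε
    obtain ⟨n, hn⟩ := (TopologicalSpace.denseRange_denseSeq X).exists_dist_lt z (half_pos hε)
    obtain ⟨l, hl⟩ := exists_nat_one_div_lt (half_pos hε)
    refine ⟨Finsupp.single (Nat.pair n l) 1, ?_⟩
    rw [him, Nat.unpair_pair, ← dist_eq_norm]
    rw [← f.dist_map] at hn
    linarith [dist_triangle (f z) (f (x n)) (κ (m n l)), hm n l]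
  let e : (ℕ →₀ 𝕜) →ₗ[𝕜] Y := Finsupp.linearCombination 𝕜 (TopologicalSpace.denseSeq Y)
  have he : DenseRange e := (TopologicalSpace.denseRange_denseSeq Y).mono (by
    rintro _ ⟨n, rfl⟩
    exact ⟨Finsupp.single n 1, by simp [e]⟩)
  -- The pushout of `V` and `Y` along `f` is pulled back to free generators, so that realizing it
  -- yields a copy of `Y` correctly placed over the approximants of the range of `f`.
  let q₀ := amalgam (normSeminorm 𝕜 V) (normSeminorm 𝕜 Y) f.toLinearMap X.subtype
  have hf : ∀ z : X, normSeminorm 𝕜 V (f.toLinearMap z) = normSeminorm 𝕜 Y (X.subtype z) :=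
    fun z => f.norm_map z
  let q : Seminorm 𝕜 ((ℕ →₀ 𝕜) × (ℕ →₀ 𝕜)) := q₀.comp ((κ ∘ₗ i).prodMap e)
  have hq : ∀ a b, q (a, b) = q₀ (κ (i a), e b) := fun _ _ => rfl
  obtain ⟨k, hk⟩ := hi q fun a => by
    rw [hq, map_zero]
    exact (amalgam_left _ _ _ _ (fun z => (hf z).le) _).symm
  have hke : ∀ b, ‖(κ ∘ₗ k) b‖ = ‖e b‖ := fun b => by
    have := hk 0 b
    rw [map_zero, zero_add, hq, map_zero, map_zero] at this
    exact this.trans (amalgam_right _ _ _ _ (fun z => (hf z).ge) _)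
  let g := (κ ∘ₗ k).extendOfNorm e
  have hg : ∀ y, ‖g y‖ = ‖y‖ := norm_extendOfNorm_of_norm_eq he hke
  have hgk : ∀ b, g (e b) = κ (k b) :=
    LinearMap.extendOfNorm_eq he ⟨1, fun b => by rw [one_mul, hke]⟩
  refine ⟨⟨g.toLinearMap, hg⟩, fun z => ?_⟩
  change g z = f z
  refine eq_of_forall_dist_le fun ε hε => ?_
  obtain ⟨a, ha⟩ := happrox z (ε / 4) (by positivity)
  obtain ⟨b, hb⟩ := he.exists_dist_lt (z : Y) (show 0 < ε / 4 by positivity)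
  -- Gluing at `-z` shows that `κ (k b)` and `κ (i a)` are close when they approximate `g z` and `f
  -- z`. The two errors each occur twice below, hence `ε / 4`.
  have h1 : ‖κ (i (-a) + k b)‖ ≤ ‖f z - κ (i a)‖ + dist (z : Y) (e b) := by
    rw [hk, hq]
    refine (amalgam_le _ _ _ _ _ (-z)).trans_eq ?_
    rw [dist_comm, dist_eq_norm]
    simp only [coe_normSeminorm, map_neg, LinearIsometry.coe_toLinearMap, Submodule.subtype_apply]
    congr 2 <;> abel
  have h2 : ‖g z - κ (k b)‖ = dist (z : Y) (e b) := by
    rw [← hgk, ← map_sub, hg, dist_eq_norm]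
  have h3 : g z - f z = (g z - κ (k b)) + κ (i (-a) + k b) - (f z - κ (i a)) := by
    simp only [map_add, map_neg]; abel
  rw [dist_eq_norm, h3]
  refine (norm_sub_le _ _).trans ((add_le_add (norm_add_le _ _) le_rfl).trans ?_)
  linarith

open Filter in
/-- Under the continuum hypothesis, a 1-separably injective space `E` of size continuum has an
extension with a contractive retraction onto `E` in which all one-step extensions of countably
generated parts are realized. -/
theorem exists_realizing_seminorm (CH : continuum.{0} = aleph 1) {E : Type u}
    [NormedAddCommGroup E] [NormedSpace 𝕜 E] [CompleteSpace E]
    (hE : OneSeparablyInjective 𝕜 E) (hM : Coded (E × (ℝ →₀ 𝕜))) :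
    ∃ (p : Seminorm 𝕜 (E × (ℝ →₀ 𝕜))) (r : E × (ℝ →₀ 𝕜) →ₗ[𝕜] E), (∀ m, ‖r m‖ ≤ p m) ∧
      (∀ e, p (e, 0) = ‖e‖) ∧ (∀ e, r (e, 0) = e) ∧
      ∀ m : ℕ → E × (ℝ →₀ 𝕜), ∃ i : (ℕ →₀ 𝕜) →ₗ[𝕜] E × (ℝ →₀ 𝕜),
        (∀ n, p (i (Finsupp.single n 1) - m n) = 0) ∧
        ∀ q : Seminorm 𝕜 ((ℕ →₀ 𝕜) × (ℕ →₀ 𝕜)), (∀ a, p (i a) = q (a, 0)) →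
          ∃ k : (ℕ →₀ 𝕜) →ₗ[𝕜] E × (ℝ →₀ 𝕜), ∀ a b, p (i a + k b) = q (a, b) := by
  -- A task is a countably generated part together with a seminorm extending its own; both are
  -- determined by countable data.
  have hT := (Coded.finsupp_linearMap 𝕜 hM).prod (Coded.seminorm_finsupp_prod 𝕜)
  obtain ⟨I, _, _, _, hI, hIc, hIb⟩ := exists_omega_one_order
  obtain ⟨τ, hτ⟩ := hT.exists_surjective CH hI
  obtain ⟨c, hc, hc'⟩ := exists_generic_chain (Stage.initial : Stage 𝕜 E)
    Stage.exists_upperBound hIc τ hτ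
    (fun t s => (∀ n, coordProj 𝕜 E s.supp (t.1 n) = t.1 n) ∧
      ∀ n, s.seminorm (t.1 n) = t.2 (n, 0))
    (fun t s => ∃ h : (ℕ →₀ 𝕜) →ₗ[𝕜] E × (ℝ →₀ 𝕜), ∀ a b,
      coordProj 𝕜 E s.supp (t.1 a + h b) = t.1 a + h b ∧
        s.seminorm (t.1 a + h b) = t.2 (a, b))
    (fun t s hts => s.exists_extension hE t.1 hts.1 t.2 hts.2)
  have hA : Monotone fun i => (c i).supp := Stage.supp_mono.comp hc
  obtain ⟨p, r, hpr⟩ := Stage.exists_limit hc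
  have hp : ∀ j m, coordProj 𝕜 E (c j).supp m = m → p m = (c j).seminorm m := by
    intro j m hm
    obtain ⟨i, hi, hji⟩ := ((hpr m).and (eventually_ge_atTop j)).exists
    rw [hi.1, coordProj_eq_self_mono (hA hji) hm]
    exact Stage.seminorm_eq_of_le (hc hji) hm
  refine ⟨p, r, fun m => ?_, fun e => ?_, fun e => ?_, fun m => ?_⟩
  · obtain ⟨i, hi⟩ := (hpr m).exists
    rw [hi.1, hi.2]
    exact (c i).norm_ret_le _
  · obtain ⟨i⟩ := ‹Nonempty I›
    rw [hp i _ (coordProj_inl (𝕜 := 𝕜) (c i).supp e), (c i).seminorm_inl]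
  · obtain ⟨i, hi⟩ := (hpr (e, 0)).exists
    rw [hi.2, coordProj_inl, (c i).ret_inl]
  -- Coordinates outside every support have seminorm zero in the limit, so each `m n` may be
  -- replaced by its projection.
  · let A := ⋃ i, (c i).supp
    have hcA : ∀ i, (c i).supp ⊆ A := Set.subset_iUnion fun i => (c i).supp
    have hi₀ : ∀ n, ∃ i, coordProj 𝕜 E (c i).supp (coordProj 𝕜 E A (m n)) =
        coordProj 𝕜 E A (m n) := fun n => by
      obtain ⟨i, hi⟩ := (eventually_coordProj_eq hA (m n)).exists
      refine ⟨i, ?_⟩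
      rw [coordProj_coordProj_of_subset (hcA i)]
      exact hi
    choose j hj using hi₀
    -- Countable subsets of `ω₁` are bounded, so all generators lie in one stage.
    obtain ⟨j₀, hj₀⟩ := hIb j
    let i : (ℕ →₀ 𝕜) →ₗ[𝕜] E × (ℝ →₀ 𝕜) :=
      Finsupp.linearCombination 𝕜 fun n => coordProj 𝕜 E A (m n)
    have hi1 : ∀ n, i (Finsupp.single n 1) = coordProj 𝕜 E A (m n) := fun n => by simp [i]
    have hij : ∀ l, j₀ ≤ l → ∀ a, coordProj 𝕜 E (c l).supp (i a) = i a := by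
      intro l hl a
      have : coordProj 𝕜 E (c l).supp ∘ₗ i = i := by
        refine Finsupp.lhom_ext' fun n => LinearMap.ext_ring ?_
        simp only [LinearMap.comp_apply, Finsupp.lsingle_apply, hi1]
        exact coordProj_eq_self_mono (hA ((hj₀ n).trans hl)) (hj n)
      exact LinearMap.congr_fun this a
    refine ⟨i, fun n => ?_, fun q hq => ?_⟩
    · obtain ⟨l, hl⟩ := (hpr (i (Finsupp.single n 1) - m n)).exists
      rw [hl.1, hi1, map_sub, coordProj_coordProj_of_subset (hcA l), sub_self, map_zero]
    · obtain ⟨l, k, hk⟩ := hc' (i, q) ⟨j₀, fun l hl => ⟨hij l hl, fun a =>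
        (hp l _ (hij l hl a)).symm.trans (hq a)⟩⟩
      exact ⟨k, fun a b => (hp l _ (hk a b).1).trans (hk a b).2⟩

/-- Under the continuum hypothesis, a 1-separably injective space of size continuum is
1-complemented in a space of universal disposition for separable spaces of size continuum. -/
theorem exists_universalDisposition_of_injective (CH : continuum.{0} = aleph 1) {E : Type u}
    [NormedAddCommGroup E] [NormedSpace 𝕜 E] [CompleteSpace E]
    (hE : OneSeparablyInjective 𝕜 E) (hEc : Coded E) :
    ∃ (V : Type u) (_ : NormedAddCommGroup V) (_ : NormedSpace 𝕜 V) (_ : CompleteSpace V),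
      Coded V ∧ UniversalDispositionForSeparable 𝕜 V ∧
        ∃ (ι : E →ₗᵢ[𝕜] V) (r : V →L[𝕜] E), ‖r‖ ≤ 1 ∧ ∀ e, r (ι e) = e := by
  have hM : Coded (E × (ℝ →₀ 𝕜)) := hEc.prod (Coded.real.finsupp (Coded.rclike 𝕜))
  obtain ⟨p, r, hrp, hpE, hrE, hp⟩ := exists_realizing_seminorm CH hE hM
  obtain ⟨V, i1, i2, i3, κ, hκ, hκd⟩ := Seminorm.exists_completion_of_coded.{u} p hM id
    (fun x ε hε => ⟨x, by simpa using hε⟩)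
  have hr : ∀ m, ‖r m‖ ≤ 1 * ‖κ m‖ := fun m => by
    rw [one_mul, hκ]
    exact hrp m
  refine ⟨V, i1, i2, i3, hM.of_denseRange _ hκd, ?_,
    ⟨κ ∘ₗ LinearMap.inl 𝕜 E (ℝ →₀ 𝕜), fun e => (hκ _).trans (hpE e)⟩,
    r.extendOfNorm κ, LinearMap.opNorm_extendOfNorm_le hκd zero_le_one hr, fun e =>
      (LinearMap.extendOfNorm_eq hκd ⟨1, hr⟩ (e, 0)).trans (hrE e)⟩
  refine universalDispositionForSeparable_of_realizes κ hκd fun m => ?_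
  obtain ⟨i, hi, hq⟩ := hp m
  refine ⟨i, fun n => ?_, fun q hqi => ?_⟩
  · rw [← sub_eq_zero, ← map_sub, ← norm_eq_zero, hκ, hi]
  · obtain ⟨k, hk⟩ := hq q fun a => (hκ _).symm.trans (hqi a)
    exact ⟨k, fun a b => (hκ _).trans (hk a b)⟩

/-- A space of universal disposition for separable spaces of size continuum has density `ℵ₁`
under the continuum hypothesis. -/
theorem UniversalDispositionForSeparable.density_eq (CH : continuum.{0} = aleph 1) {V : Type u}
    [NormedAddCommGroup V] [NormedSpace 𝕜 V] [CompleteSpace V]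
    (hV : UniversalDispositionForSeparable 𝕜 V) (hc : Coded V) : density V = aleph 1 := by
  refine le_antisymm ?_ (aleph_one_le_density hV.not_separableSpace)
  rw [← continuum_eq_aleph_one CH]
  exact (density_le_mk dense_univ).trans (mk_univ.trans_le hc.mk_le)

theorem Coded.of_density_le (CH : continuum.{0} = aleph 1) {E : Type u} [MetricSpace E]
    (h : density E ≤ aleph 1) : Coded E := by
  obtain ⟨s, hs, hs'⟩ := exists_dense_mk_eq_density E
  rw [← hs', ← continuum_eq_aleph_one CH] at h
  exact (Coded.of_mk_le_continuum h).of_denseRange _ hs.denseRange_val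

/-- The range of an isometry with a contractive left inverse is 1-complemented. -/
theorem isOneComplemented_range {E V : Type u} [NormedAddCommGroup E] [NormedSpace 𝕜 E]
    [NormedAddCommGroup V] [NormedSpace 𝕜 V] (ι : E →ₗᵢ[𝕜] V) (r : V →L[𝕜] E) (hr : ‖r‖ ≤ 1)
    (h : ∀ e, r (ι e) = e) : IsOneComplemented (LinearMap.range ι.toLinearMap) := by
  refine ⟨ι.toContinuousLinearMap ∘L r, ?_, ?_, le_antisymm ?_ ?_⟩
  · ext v
    simp [h]
  · refine ContinuousLinearMap.opNorm_le_bound _ zero_le_one fun v => ?_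
    exact (ι.norm_map _).trans_le (r.le_of_opNorm_le hr v)
  · rintro _ ⟨v, rfl⟩
    exact ⟨r v, rfl⟩
  · rintro _ ⟨e, rfl⟩
    exact ⟨ι e, congrArg ι (h e)⟩

end Existence

/-! ### The main theorem -/

theorem mainTheorem9 (𝕜 : Type*) [RCLike 𝕜]
    (CH : Cardinal.continuum.{0} = Cardinal.aleph 1) :
    -- a Banach space of density `ℵ₁` and of universal disposition for separable spaces exists,
    (∃ (V : Type u) (_ : NormedAddCommGroup V) (_ : NormedSpace 𝕜 V),
      CompleteSpace V ∧ density V = Cardinal.aleph 1 ∧ UniversalDispositionForSeparable 𝕜 V) ∧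
    -- it is unique up to a linear isometry,
    (∀ (V W : Type u) [NormedAddCommGroup V] [NormedSpace 𝕜 V] [CompleteSpace V]
      [NormedAddCommGroup W] [NormedSpace 𝕜 W] [CompleteSpace W],
      density V = Cardinal.aleph 1 → UniversalDispositionForSeparable 𝕜 V →
      density W = Cardinal.aleph 1 → UniversalDispositionForSeparable 𝕜 W →
      Nonempty (V ≃ₗᵢ[𝕜] W)) ∧
    -- and its 1-complemented subspaces are characterized by 1-separable injectivity.
    (∀ (V : Type u) [NormedAddCommGroup V] [NormedSpace 𝕜 V] [CompleteSpace V],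
      density V = Cardinal.aleph 1 → UniversalDispositionForSeparable 𝕜 V →
      ∀ (E : Type u) [NormedAddCommGroup E] [NormedSpace 𝕜 E] [CompleteSpace E],
        density E ≤ Cardinal.aleph 1 →
        ((∃ F : Submodule 𝕜 V, IsOneComplemented F ∧ Nonempty (E ≃ₗᵢ[𝕜] F)) ↔
          OneSeparablyInjective 𝕜 E)) := by
  refine ⟨?_, ?_, ?_⟩
  -- Existence is the construction around the zero space.
  · have hE : OneSeparablyInjective 𝕜 PUnit.{u + 1} :=
      fun Y _ _ _ _ X _ T => ⟨0, fun x => Subsingleton.elim _ _, by simp⟩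
    obtain ⟨V, i1, i2, i3, hc, hV, -⟩ :=
      exists_universalDisposition_of_injective CH hE (Coded.of_countable _)
    exact ⟨V, i1, i2, i3, hV.density_eq CH hc, hV⟩
  · intro V W _ _ _ _ _ _ hVd hV hWd hW
    exact hV.nonempty_linearIsometryEquiv CH hVd hWd hW
  · intro V _ _ _ hVd hV E _ _ _ hEd
    constructor
    · rintro ⟨F, hF, ⟨φ⟩⟩
      exact hV.oneSeparablyInjective.of_isOneComplemented hF φ
    · intro hE
      -- The space `W` built around `E` is isometric to `V` by uniqueness, and the embedding and
      -- retraction are transported.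
      obtain ⟨W, _, _, _, hc, hW, ι, r, hr, h⟩ :=
        exists_universalDisposition_of_injective CH hE (Coded.of_density_le CH hEd)
      obtain ⟨ψ⟩ := hW.nonempty_linearIsometryEquiv CH (hW.density_eq CH hc) hVd hV
      refine ⟨_, isOneComplemented_range (ψ.toLinearIsometry.comp ι)
        (r ∘L ψ.symm.toLinearIsometry.toContinuousLinearMap) ?_ fun e => ?_,
        ⟨(ψ.toLinearIsometry.comp ι).equivRange⟩⟩
      · refine ContinuousLinearMap.opNorm_le_bound _ zero_le_one fun v => ?_
        refine (r.le_of_opNorm_le hr _).trans_eq ?_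
        exact congrArg _ (ψ.symm.norm_map v)
      · simp [h]
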